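/- Let $\mathbb{K}$ be $\mathbb{R}$ or $\mathbb{C}$, write $\mathbb{P}^k$ for the $k$-dimensional projective space over $\mathbb{K}$, and let $n \ge 8$. A flatland camera is a linear projection $A : \mathbb{P}^2 \dashrightarrow \mathbb{P}^1$ given by a $2\times 3$ matrix over $\mathbb{K}$ of rank $2$; it is defined at every point of $\mathbb{P}^2$ except its center, the point spanned by the null space of the matrix. Then for generic labeled sets $\mathcal{X} = \{x_1,\dots,x_n\}$ and $\mathcal{Y} = \{y_1,\dots,y_n\}$ of points in $\mathbb{P}^2$, there is no pair $(A,B)$ of flatland cameras that projects $\mathcal{X}$ and $\mathcal{Y}$ to the same image in $\mathbb{P}^1$. That is, there is a dense Zariski-open subset $U \subseteq (\mathbb{P}^2)^n \times (\mathbb{P}^2)^n$ such that for every $(\mathcal{X},\mathcal{Y}) \in U$ there are no flatland cameras $A, B$ such that, for all $i = 1,\dots,n$, $A$ is defined at $x_i$, $B$ is defined at $y_i$, and $A x_i = B y_i$ in $\mathbb{P}^1$. -/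

import Mathlib

open scoped LinearAlgebra.Projectivization Matrix

/-- The projective space `ℙᵏ` over `𝕜`, with homogeneous coordinates indexed by `Fin (k + 1)`. -/
abbrev ProjSpace (𝕜 : Type*) [Field 𝕜] (k : ℕ) : Type _ := ℙ 𝕜 (Fin (k + 1) → 𝕜)

/-- A flatland camera `ℙ² ⇢ ℙ¹`, given by a `2 × 3` matrix of rank `2`. -/
structure FlatlandCamera (𝕜 : Type*) [Field 𝕜] where
  mat : Matrix (Fin 2) (Fin 3) 𝕜
  rank_eq : mat.rank = 2

/-- The camera `A` is defined at `x` (that is, `x` is not its center) and maps `x` to `p`.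
This does not depend on the representative of `x`. -/
def FlatlandCamera.ProjectsTo {𝕜 : Type*} [Field 𝕜] (A : FlatlandCamera 𝕜)
    (x : ProjSpace 𝕜 2) (p : ProjSpace 𝕜 1) : Prop :=
  ∃ h : A.mat *ᵥ x.rep ≠ 0, Projectivization.mk 𝕜 (A.mat *ᵥ x.rep) h = p

/-- The cameras `A` and `B` project the labeled points `X` and `Y` to the same labeled image
in `ℙ¹`. -/
def SameImage {𝕜 : Type*} [Field 𝕜] {n : ℕ} (A B : FlatlandCamera 𝕜)
    (X Y : Fin n → ProjSpace 𝕜 2) : Prop :=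
  ∃ P : Fin n → ProjSpace 𝕜 1, ∀ i, A.ProjectsTo (X i) (P i) ∧ B.ProjectsTo (Y i) (P i)

/-- A polynomial in the homogeneous coordinates of a family of points of `ℙᵏ` is multihomogeneous
if it is homogeneous in the coordinates of each point separately. -/
def IsMultihomogeneous {𝕜 : Type*} [Field 𝕜] {ι : Type*} [DecidableEq ι] {k : ℕ}
    (f : MvPolynomial (ι × Fin (k + 1)) 𝕜) : Prop :=
  ∃ d : ι → ℕ, f.IsWeightedHomogeneous (fun v => (Pi.single v.1 1 : ι → ℕ)) d

/-- The nonvanishing locus of `f` in `(ℙᵏ)^ι`. For multihomogeneous `f` it does not depend on the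
representatives. -/
def nonvanishingLocus {𝕜 : Type*} [Field 𝕜] {ι : Type*} {k : ℕ}
    (f : MvPolynomial (ι × Fin (k + 1)) 𝕜) : Set (ι → ProjSpace 𝕜 k) :=
  {z | MvPolynomial.eval (fun v => (z v.1).rep v.2) f ≠ 0}

/-- The Zariski topology on `(ℙᵏ)^ι`: the topology generated by the nonvanishing loci of
multihomogeneous polynomials (not the product topology). -/
abbrev zariskiTopology (𝕜 : Type*) [Field 𝕜] (ι : Type*) [DecidableEq ι] (k : ℕ) :
    TopologicalSpace (ι → ProjSpace 𝕜 k) :=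
  TopologicalSpace.generateFrom
    {U | ∃ f : MvPolynomial (ι × Fin (k + 1)) 𝕜, IsMultihomogeneous f ∧ U = nonvanishingLocus f}

/-- A property of pairs `(X, Y)` of `n` labeled points of `ℙ²` holds generically if it holds on a
dense Zariski-open subset of `(ℙ²)ⁿ × (ℙ²)ⁿ`. -/
def HoldsGenerically {𝕜 : Type*} [Field 𝕜] {n : ℕ}
    (Q : (Fin n → ProjSpace 𝕜 2) → (Fin n → ProjSpace 𝕜 2) → Prop) : Prop :=
  ∃ U : Set (Fin n ⊕ Fin n → ProjSpace 𝕜 2),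
    @IsOpen _ (zariskiTopology 𝕜 (Fin n ⊕ Fin n) 2) U ∧
    @Dense _ (zariskiTopology 𝕜 (Fin n ⊕ Fin n) 2) U ∧
    ∀ X Y, Sum.elim X Y ∈ U → Q X Y

/-! If `A x_i = B y_i` for all `i`, the bilinear form `det (A u, B v)` is nonzero, has rank at most
2, and vanishes at every pair `(x_i, y_i)`. Bilinear forms on 3-space have 9 coefficients, so eight
generic pairs leave one form up to scale, whose coefficients are 8 × 8 minors (`minorForm`). Its
determinant is a multihomogeneous polynomial that must vanish when cameras exist
(`det_minorForm_eq_zero`). It is not identically zero, since for one explicit configuration the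
surviving form is the identity (`det_minorForm_orthogonal_ne_zero`); its nonvanishing locus is the
required open set. -/

namespace Matrix

/-- Cramer's rule for a vector annihilated by all rows but one. -/
theorem det_updateRow_smul_eq {ι R : Type*} [Fintype ι] [DecidableEq ι] [CommRing R]
    (T : Matrix ι ι R) (i : ι) (v w : ι → R) (h : ∀ r, r ≠ i → (T *ᵥ v) r = 0) :
    (T.updateRow i w).det • v = (w ⬝ᵥ v) • fun c => T.adjugate c i := by
  have hv : T.updateRow i w *ᵥ v = (w ⬝ᵥ v) • Pi.single i 1 := by
    ext r
    by_cases hr : r = i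
    · subst hr
      simp [mulVec]
    · simpa [mulVec, hr] using h r hr
  have hadj : ∀ c, (T.updateRow i w).adjugate c i = T.adjugate c i := by
    intro c
    rw [adjugate_apply, adjugate_apply, updateRow_idem]
  have := congrArg (fun u => (T.updateRow i w).adjugate *ᵥ u) hv
  simp only [mulVec_mulVec, adjugate_mul, smul_mulVec, one_mulVec, mulVec_smul,
    mulVec_single_one] at this
  rw [this]
  congr 1
  ext c
  exact hadj c

theorem isWeightedHomogeneous_det {ι σ R M : Type*} [Fintype ι] [DecidableEq ι] [CommRing R]
    [AddCommMonoid M] {w : σ → M} {d : ι → M} {T : Matrix ι ι (MvPolynomial σ R)}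
    (hT : ∀ i j, (T i j).IsWeightedHomogeneous w (d i)) :
    T.det.IsWeightedHomogeneous w (∑ i, d i) := by
  rw [← det_transpose, det_apply]
  refine MvPolynomial.IsWeightedHomogeneous.sum _ _ _ fun τ _ => ?_
  have hprod := MvPolynomial.IsWeightedHomogeneous.prod Finset.univ (fun i => T i (τ i)) d
    fun i _ => hT i (τ i)
  rcases Int.units_eq_one_or (Equiv.Perm.sign τ) with hs | hs
  · simpa [hs] using hprod
  · simpa [hs] using hprod.neg

theorem mulVec_surjective_of_rank_eq_two {K : Type*} [Field K] {A : Matrix (Fin 2) (Fin 3) K}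
    (hA : A.rank = 2) : Function.Surjective (A *ᵥ ·) := by
  have : LinearMap.range A.mulVecLin = ⊤ := by
    apply Submodule.eq_top_of_finrank_eq
    rw [← Matrix.rank, hA]
    simp
  exact LinearMap.range_eq_top.mp this

end Matrix

namespace MvPolynomial

/-- Scaling each block of variables scales the value of a multihomogeneous polynomial. -/
theorem eval_smul_of_isWeightedHomogeneous {K ι κ : Type*} [CommRing K] [Fintype ι]
    [DecidableEq ι] [Fintype κ] {f : MvPolynomial (ι × κ) K} {d : ι → ℕ}
    (hf : f.IsWeightedHomogeneous (fun v => (Pi.single v.1 1 : ι → ℕ)) d)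
    (a : ι → K) (x : ι × κ → K) :
    eval (fun v => a v.1 * x v) f = (∏ i, a i ^ d i) * eval x f := by
  rw [eval_eq', eval_eq', Finset.mul_sum]
  refine Finset.sum_congr rfl fun m hm => ?_
  have hd : ∀ i, ∑ k, m (i, k) = d i := by
    intro i
    have := congrFun (hf (mem_support_iff.mp hm)) i
    rw [Finsupp.weight_apply, Finsupp.sum_fintype _ _ (by simp), Fintype.sum_prod_type] at this
    simpa [Finset.sum_apply, Pi.single_apply, Finset.sum_ite_eq] using this
  have ha : ∏ v : ι × κ, a v.1 ^ m v = ∏ i, a i ^ d i := by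
    rw [Fintype.prod_prod_type]
    refine Finset.prod_congr rfl fun i _ => ?_
    rw [← hd, ← Finset.prod_pow_eq_pow_sum]
  simp_rw [mul_pow, Finset.prod_mul_distrib, ha]
  ring

end MvPolynomial

/-! ### Density of nonvanishing loci. -/

section Zariski

variable {𝕜 ι : Type*} [Field 𝕜] [DecidableEq ι] {k : ℕ}

theorem IsMultihomogeneous.mul {f g : MvPolynomial (ι × Fin (k + 1)) 𝕜}
    (hf : IsMultihomogeneous f) (hg : IsMultihomogeneous g) : IsMultihomogeneous (f * g) := by
  obtain ⟨d, hd⟩ := hf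
  obtain ⟨e, he⟩ := hg
  exact ⟨d + e, hd.mul he⟩

theorem nonvanishingLocus_mul {𝕜 ι : Type*} [Field 𝕜] {k : ℕ}
    (f g : MvPolynomial (ι × Fin (k + 1)) 𝕜) :
    nonvanishingLocus (f * g) = nonvanishingLocus f ∩ nonvanishingLocus g := by
  ext z
  simp [nonvanishingLocus]

theorem nonvanishingLocus_nonempty [Infinite 𝕜] [Fintype ι]
    {f : MvPolynomial (ι × Fin (k + 1)) 𝕜} (hf : IsMultihomogeneous f) (hf0 : f ≠ 0) :
    (nonvanishingLocus f).Nonempty := by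
  obtain ⟨d, hd⟩ := hf
  -- The extra factor forces every block of `x` to be nonzero, so each block defines a projective
  -- point.
  have hne : f * ∏ i : ι, MvPolynomial.X (i, 0) ≠ 0 :=
    mul_ne_zero hf0 (Finset.prod_ne_zero_iff.mpr fun i _ => MvPolynomial.X_ne_zero _)
  obtain ⟨x, hx⟩ : ∃ x, MvPolynomial.eval x (f * ∏ i : ι, MvPolynomial.X (i, 0)) ≠ 0 := by
    by_contra! h
    exact hne (MvPolynomial.funext fun x => by rw [h x, map_zero])
  rw [map_mul, map_prod] at hx
  have hx0 : ∀ i, (fun j => x (i, j)) ≠ 0 := by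
    intro i h
    have := Finset.prod_ne_zero_iff.mp (right_ne_zero_of_mul hx) i (Finset.mem_univ i)
    rw [MvPolynomial.eval_X] at this
    exact this (congrFun h 0)
  choose a ha using fun i => Projectivization.exists_smul_eq_mk_rep 𝕜 (fun j => x (i, j)) (hx0 i)
  refine ⟨fun i => Projectivization.mk 𝕜 (fun j => x (i, j)) (hx0 i), ?_⟩
  have hrep : (fun v : ι × Fin (k + 1) =>
      (Projectivization.mk 𝕜 (fun j => x (v.1, j)) (hx0 v.1)).rep v.2) =
      fun v => (a v.1 : 𝕜) * x v := by
    ext v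
    rw [← ha]
    rfl
  change MvPolynomial.eval _ f ≠ 0
  rw [hrep, MvPolynomial.eval_smul_of_isWeightedHomogeneous hd (fun i => (a i : 𝕜))]
  exact mul_ne_zero (Finset.prod_ne_zero_iff.mpr fun i _ => pow_ne_zero _ (a i).ne_zero)
    (left_ne_zero_of_mul hx)

theorem isOpen_nonvanishingLocus {f : MvPolynomial (ι × Fin (k + 1)) 𝕜}
    (hf : IsMultihomogeneous f) : @IsOpen _ (zariskiTopology 𝕜 ι k) (nonvanishingLocus f) :=
  TopologicalSpace.isOpen_generateFrom_of_mem ⟨f, hf, rfl⟩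

theorem dense_nonvanishingLocus [Infinite 𝕜] [Fintype ι]
    {f : MvPolynomial (ι × Fin (k + 1)) 𝕜} (hf : IsMultihomogeneous f) (hf0 : f ≠ 0) :
    @Dense _ (zariskiTopology 𝕜 ι k) (nonvanishingLocus f) := by
  let := zariskiTopology 𝕜 ι k
  have hb := TopologicalSpace.isTopologicalBasis_of_subbasis_of_inter
    (r := {U : Set (ι → ProjSpace 𝕜 k) | ∃ f : MvPolynomial (ι × Fin (k + 1)) 𝕜,
      IsMultihomogeneous f ∧ U = nonvanishingLocus f}) rfl (by
    rintro _ ⟨g, hg, rfl⟩ _ ⟨h, hh, rfl⟩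
    exact ⟨g * h, hg.mul hh, (nonvanishingLocus_mul g h).symm⟩)
  refine hb.dense_iff.mpr ?_
  rintro _ (rfl | ⟨g, hg, rfl⟩) ⟨z, hz⟩
  · simpa using nonvanishingLocus_nonempty hf hf0
  · rw [← nonvanishingLocus_mul]
    refine nonvanishingLocus_nonempty (hg.mul hf) (mul_ne_zero ?_ hf0)
    rintro rfl
    exact hz (map_zero _)

end Zariski

/-! ### Bilinear forms vanishing at eight pairs. -/

section Correspondence

variable {R : Type*} [CommRing R]

/-- The matrix whose rows are the flattened tensors `x r ⊗ y r`. -/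
def tensorRows (x y : Fin 3 × Fin 3 → Fin 3 → R) : Matrix (Fin 3 × Fin 3) (Fin 3 × Fin 3) R :=
  Matrix.of fun r c => x r c.1 * y r c.2

/-- A bilinear form vanishing at the pairs `(x r, y r)` for `r ≠ (2, 2)`, with coefficients the
maximal minors of the corresponding rows of `tensorRows x y`. -/
def minorForm (x y : Fin 3 × Fin 3 → Fin 3 → R) : Matrix (Fin 3) (Fin 3) R :=
  Matrix.of fun j k => (tensorRows x y).adjugate (j, k) (2, 2)

theorem map_minorForm {S : Type*} [CommRing S] (φ : R →+* S) (x y : Fin 3 × Fin 3 → Fin 3 → R) :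
    φ.mapMatrix (minorForm x y) = minorForm (fun r k => φ (x r k)) (fun r k => φ (y r k)) := by
  have h : φ.mapMatrix (tensorRows x y) =
      tensorRows (fun r k => φ (x r k)) (fun r k => φ (y r k)) := by
    ext r c
    simp [tensorRows]
  ext j k
  simp only [minorForm, RingHom.mapMatrix_apply, Matrix.map_apply, Matrix.of_apply]
  rw [← h, ← RingHom.map_adjugate]
  rfl

theorem tensorRows_mulVec (x y : Fin 3 × Fin 3 → Fin 3 → R) (G : Matrix (Fin 3) (Fin 3) R)
    (r : Fin 3 × Fin 3) :
    (tensorRows x y *ᵥ fun c => G c.1 c.2) r = x r ⬝ᵥ G *ᵥ y r := by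
  simp only [tensorRows, Matrix.mulVec, dotProduct, Matrix.of_apply, Fintype.sum_prod_type,
    Finset.mul_sum]
  refine Finset.sum_congr rfl fun j _ => Finset.sum_congr rfl fun k _ => ?_
  ring

/-- Cramer's rule, with no independence assumption on the eight conditions; `w` is a free functional
used to normalize `G`. -/
theorem det_updateRow_smul_eq_smul_minorForm (x y : Fin 3 × Fin 3 → Fin 3 → R)
    (G : Matrix (Fin 3) (Fin 3) R) (hG : ∀ r, r ≠ (2, 2) → x r ⬝ᵥ G *ᵥ y r = 0)
    (w : Fin 3 × Fin 3 → R) :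
    ((tensorRows x y).updateRow (2, 2) w).det • G =
      (w ⬝ᵥ fun c => G c.1 c.2) • minorForm x y := by
  have h := Matrix.det_updateRow_smul_eq (tensorRows x y) (2, 2) (fun c => G c.1 c.2) w
    fun r hr => by rw [tensorRows_mulVec]; exact hG r hr
  ext j k
  have hjk := congrFun h (j, k)
  simp only [Pi.smul_apply] at hjk
  rw [Matrix.smul_apply, Matrix.smul_apply, minorForm, Matrix.of_apply, hjk]

/-- If a nonzero singular bilinear form vanishes at all eight pairs, then `minorForm` is
singular. -/
theorem det_minorForm_eq_zero {K : Type*} [Field K] (x y : Fin 3 × Fin 3 → Fin 3 → K)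
    (G : Matrix (Fin 3) (Fin 3) K) (hG : ∀ r, r ≠ (2, 2) → x r ⬝ᵥ G *ᵥ y r = 0)
    (hG0 : G ≠ 0) (hdet : G.det = 0) : (minorForm x y).det = 0 := by
  obtain ⟨j, k, hjk⟩ : ∃ j k, G j k ≠ 0 := by
    by_contra! h
    exact hG0 (Matrix.ext h)
  -- With `w` reading off a nonzero entry of `G`, `minorForm` is a multiple of `G`, possibly zero.
  have h := det_updateRow_smul_eq_smul_minorForm x y G hG (Pi.single (j, k) 1)
  rw [single_one_dotProduct] at h
  have h' := congrArg Matrix.det h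
  rw [Matrix.det_smul, Matrix.det_smul, hdet, mul_zero] at h'
  exact (mul_eq_zero.mp h'.symm).resolve_left (pow_ne_zero _ hjk)

/-- Eight pairs of orthogonal vectors whose tensors span the trace-zero matrices: first entries. -/
def orthogonalLeft (K : Type*) [Field K] (r : Fin 3 × Fin 3) : Fin 3 → K :=
  if r.1 = r.2 then Pi.single r.1 1 + Pi.single 2 1 else Pi.single r.1 1

/-- Eight pairs of orthogonal vectors whose tensors span the trace-zero matrices: second
entries. -/
def orthogonalRight (K : Type*) [Field K] (r : Fin 3 × Fin 3) : Fin 3 → K :=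
  if r.1 = r.2 then Pi.single r.1 1 - Pi.single 2 1 else Pi.single r.2 1

theorem det_minorForm_orthogonal_ne_zero {K : Type*} [Field K] {x y : Fin 3 × Fin 3 → Fin 3 → K}
    (hx : ∀ r, r ≠ (2, 2) → x r = orthogonalLeft K r)
    (hy : ∀ r, r ≠ (2, 2) → y r = orthogonalRight K r) : (minorForm x y).det ≠ 0 := by
  have horth : ∀ r, r ≠ (2, 2) → x r ⬝ᵥ (1 : Matrix (Fin 3) (Fin 3) K) *ᵥ y r = 0 := by
    rintro ⟨j, k⟩ hr
    rw [hx _ hr, hy _ hr]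
    fin_cases j <;> fin_cases k <;>
      simp_all [orthogonalLeft, orthogonalRight, Fin.sum_univ_three, dotProduct, Pi.single_apply]
  have h := det_updateRow_smul_eq_smul_minorForm x y 1 horth (Pi.single (2, 2) 1)
  rw [single_one_dotProduct, Matrix.one_apply_eq, one_smul] at h
  rw [← h, Matrix.det_smul, Matrix.det_one, mul_one]
  refine pow_ne_zero _ fun h0 => ?_
  -- A kernel vector is a form killing the eight pairs with `(2, 2)` entry zero. The unit-vector
  -- pairs kill its off-diagonal entries; the pairs `e_j + e_2`, `e_j - e_2` then equate its
  -- diagonal entries.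
  obtain ⟨v, hv0, hv⟩ := Matrix.exists_mulVec_eq_zero_iff.mpr h0
  apply hv0
  have e : ∀ r, r ≠ (2, 2) → x r ⬝ᵥ (Matrix.of fun j k => v (j, k)) *ᵥ y r = 0 := by
    intro r hr
    rw [← tensorRows_mulVec x y (Matrix.of fun j k => v (j, k))]
    simpa [Matrix.mulVec, hr] using congrFun hv r
  have e22 : v (2, 2) = 0 := by
    simpa [Matrix.mulVec] using congrFun hv (2, 2)
  have hoff : ∀ j k, j ≠ k → v (j, k) = 0 := by
    intro j k hjk
    have hr : (j, k) ≠ (2, 2) := by rintro ⟨⟩; exact hjk rfl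
    have := e (j, k) hr
    rw [hx _ hr, hy _ hr] at this
    simpa [orthogonalLeft, orthogonalRight, hjk] using this
  have hdiag : ∀ j, v (j, j) = 0 := by
    intro j
    by_cases hj : j = 2
    · rw [hj, e22]
    · have hr : (j, j) ≠ (2, 2) := by rintro ⟨⟩; exact hj rfl
      have := e (j, j) hr
      rw [hx _ hr, hy _ hr] at this
      simpa [orthogonalLeft, orthogonalRight, Matrix.mulVec_add, Matrix.mulVec_sub,
        add_dotProduct, hoff j 2 hj, hoff 2 j (Ne.symm hj), e22] using this
  ext ⟨j, k⟩
  by_cases hjk : j = k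
  · subst hjk
    exact hdiag j
  · exact hoff j k hjk

end Correspondence

/-! ### The singular form of a camera pair. -/

section Cameras

variable {K : Type*} [Field K]

/-- The bilinear form `(u, v) ↦ det (A u, B v)`. -/
def fundamentalMatrix (A B : Matrix (Fin 2) (Fin 3) K) : Matrix (Fin 3) (Fin 3) K :=
  Aᵀ * ((!![0, 1; -1, 0] : Matrix (Fin 2) (Fin 2) K) * B)

theorem dotProduct_fundamentalMatrix_mulVec (A B : Matrix (Fin 2) (Fin 3) K) (u v : Fin 3 → K) :
    u ⬝ᵥ fundamentalMatrix A B *ᵥ v =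
      (A *ᵥ u) 0 * (B *ᵥ v) 1 - (A *ᵥ u) 1 * (B *ᵥ v) 0 := by
  rw [fundamentalMatrix, ← Matrix.mulVec_mulVec, Matrix.dotProduct_mulVec, Matrix.vecMul_transpose,
    ← Matrix.mulVec_mulVec]
  generalize A *ᵥ u = a
  generalize B *ᵥ v = b
  simp [dotProduct, Matrix.mulVec, Fin.sum_univ_two]
  ring

theorem fundamentalMatrix_ne_zero (A B : FlatlandCamera K) :
    fundamentalMatrix A.mat B.mat ≠ 0 := by
  intro h
  obtain ⟨u, hu⟩ := Matrix.mulVec_surjective_of_rank_eq_two A.rank_eq ![1, 0]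
  obtain ⟨v, hv⟩ := Matrix.mulVec_surjective_of_rank_eq_two B.rank_eq ![0, 1]
  have := dotProduct_fundamentalMatrix_mulVec A.mat B.mat u v
  simp only at hu hv
  rw [h, hu, hv] at this
  simp at this

/-- The product factors through a 2-dimensional space. -/
theorem det_fundamentalMatrix (A B : Matrix (Fin 2) (Fin 3) K) :
    (fundamentalMatrix A B).det = 0 := by
  by_contra h
  have hrank := Matrix.rank_of_isUnit _
    ((Matrix.isUnit_iff_isUnit_det (fundamentalMatrix A B)).mpr (isUnit_iff_ne_zero.mpr h))
  have hle := (Matrix.rank_mul_le_left Aᵀ ((!![0, 1; -1, 0] : Matrix (Fin 2) (Fin 2) K) * B)).trans (Matrix.rank_le_width Aᵀ)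
  rw [← fundamentalMatrix, hrank] at hle
  simp at hle

theorem SameImage.dotProduct_fundamentalMatrix_mulVec_eq_zero {n : ℕ} {A B : FlatlandCamera K}
    {X Y : Fin n → ProjSpace K 2} (h : SameImage A B X Y) (i : Fin n) :
    (X i).rep ⬝ᵥ fundamentalMatrix A.mat B.mat *ᵥ (Y i).rep = 0 := by
  obtain ⟨P, hP⟩ := h
  obtain ⟨⟨hA, hAP⟩, hB, hBP⟩ := hP i
  obtain ⟨a, ha⟩ := (Projectivization.mk_eq_mk_iff' K _ _ hA hB).mp (hAP.trans hBP.symm)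
  rw [dotProduct_fundamentalMatrix_mulVec, ← ha]
  simp only [Pi.smul_apply, smul_eq_mul]
  ring

end Cameras

/-! ### The determinant as a polynomial. -/

section GenericForm

variable (K : Type*) [Field K] {n : ℕ} (σ : Fin 3 × Fin 3 → Fin n)

/-- The determinant of `minorForm` as a polynomial in the coordinates of the points labeled by
`σ`. -/
noncomputable def minorFormDetPoly : MvPolynomial ((Fin n ⊕ Fin n) × Fin 3) K :=
  (minorForm (fun r k => MvPolynomial.X (Sum.inl (σ r), k))
    (fun r k => MvPolynomial.X (Sum.inr (σ r), k))).det

theorem eval_minorFormDetPoly (z : (Fin n ⊕ Fin n) × Fin 3 → K) :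
    MvPolynomial.eval z (minorFormDetPoly K σ) =
      (minorForm (fun r k => z (Sum.inl (σ r), k)) (fun r k => z (Sum.inr (σ r), k))).det := by
  rw [minorFormDetPoly, RingHom.map_det, map_minorForm]
  simp

theorem isMultihomogeneous_minorFormDetPoly :
    IsMultihomogeneous (k := 2) (minorFormDetPoly K σ) := by
  -- Row `(2, 2)` has degree 0 because the adjugate replaces it by a unit vector.
  refine ⟨_, Matrix.isWeightedHomogeneous_det (d := fun _ => ∑ r : Fin 3 × Fin 3,
    if r = (2, 2) then 0 else
      (Pi.single (Sum.inl (σ r)) 1 + Pi.single (Sum.inr (σ r)) 1 : Fin n ⊕ Fin n → ℕ))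
    fun j k => ?_⟩
  rw [minorForm, Matrix.of_apply, Matrix.adjugate_apply]
  refine Matrix.isWeightedHomogeneous_det fun r c => ?_
  by_cases hr : r = (2, 2)
  · subst hr
    rw [Matrix.updateRow_self, if_pos rfl, Pi.single_apply]
    split_ifs
    · exact MvPolynomial.isWeightedHomogeneous_one _ _
    · exact MvPolynomial.isWeightedHomogeneous_zero _ _ _
  · rw [Matrix.updateRow_ne hr, if_neg hr]
    exact (MvPolynomial.isWeightedHomogeneous_X _ _ _).mul
      (MvPolynomial.isWeightedHomogeneous_X _ _ _)

theorem minorFormDetPoly_ne_zero (τ : Fin n → Fin 3 × Fin 3)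
    (hτ : ∀ r, r ≠ (2, 2) → τ (σ r) = r) : minorFormDetPoly K σ ≠ 0 := by
  intro h
  have heval := eval_minorFormDetPoly K σ fun v =>
    Sum.elim (fun i => orthogonalLeft K (τ i)) (fun i => orthogonalRight K (τ i)) v.1 v.2
  rw [h, map_zero] at heval
  refine det_minorForm_orthogonal_ne_zero (fun r hr => ?_) (fun r hr => ?_) heval.symm
  · simp [hτ r hr]
  · simp [hτ r hr]

end GenericForm

theorem exists_labeling {n : ℕ} (hn : 8 ≤ n) :
    ∃ (σ : Fin 3 × Fin 3 → Fin n) (τ : Fin n → Fin 3 × Fin 3),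
      ∀ r, r ≠ (2, 2) → τ (σ r) = r := by
  have h : ∀ r : Fin 3 × Fin 3, r ≠ (2, 2) →
      finProdFinEquiv.symm (Fin.ofNat 9 (min (finProdFinEquiv r).val 7)) = r := by decide
  -- The unused row `(2, 2)` has index 8, out of range when `n = 8`, hence the cap at 7.
  exact ⟨fun r => ⟨min (finProdFinEquiv r).val 7, by omega⟩,
    fun i => finProdFinEquiv.symm (Fin.ofNat 9 i.val), h⟩

theorem mainTheorem7 (𝕜 : Type*) [RCLike 𝕜] (n : ℕ) (hn : 8 ≤ n) :
    HoldsGenerically (fun X Y : Fin n → ProjSpace 𝕜 2 =>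
      ¬ ∃ A B : FlatlandCamera 𝕜, SameImage A B X Y) := by
  obtain ⟨σ, τ, hτ⟩ := exists_labeling hn
  have : Infinite 𝕜 := .of_injective _ (Nat.cast_injective (R := 𝕜))
  have hf := isMultihomogeneous_minorFormDetPoly 𝕜 σ
  refine ⟨nonvanishingLocus (minorFormDetPoly 𝕜 σ), isOpen_nonvanishingLocus hf,
    dense_nonvanishingLocus hf (minorFormDetPoly_ne_zero 𝕜 σ τ hτ), ?_⟩
  rintro X Y hXY ⟨A, B, hAB⟩
  refine hXY ?_
  rw [eval_minorFormDetPoly]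
  exact det_minorForm_eq_zero _ _ _
    (fun r _ => hAB.dotProduct_fundamentalMatrix_mulVec_eq_zero (σ r))
    (fundamentalMatrix_ne_zero A B) (det_fundamentalMatrix A.mat B.mat)
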